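/- Let $X$ be an infinite-dimensional complex Banach space and let $\mathcal B(X)$ be the algebra of bounded linear operators on $X$. For $T\in\mathcal B(X)$ let $\sigma(T)$ be its spectrum, $\sigma_a(T)=\{\lambda\in\mathbb C: T-\lambda I \text{ is not bounded below}\}$ its approximate point spectrum, and $\sigma_W(T)=\{\lambda\in\mathbb C: T-\lambda I\text{ is not a Fredholm operator of index }0\}$ its Weyl spectrum, where an operator is Fredholm if its null space has finite dimension and its range is closed of finite codimension, and its index is the difference of these two numbers. Let $E_a(T)$ be the set of eigenvalues of $T$ that are isolated points of $\sigma_a(T)$. Let $\Pi^0(T)$ be the set of poles of the resolvent of $T$ of finite rank, that is, of those $\lambda\in\sigma(T)$ for which $T-\lambda I$ has finite ascent and finite descent and $\bigcup_{n}\ker (T-\lambda I)^n$ (the range of the spectral projection at $\lambda$) is finite-dimensional. Say that $T$ has property $(Z_{E_a})$ if $\sigma(T)\setminus\sigma_W(T)=E_a(T)$. Let $R\in\mathcal B(X)$ be a Riesz operator, that is, $R-\mu I$ is Fredholm for every nonzero $\mu\in\mathbb C$, and let $T\in\mathcal B(X)$ commute with $R$. If $T$ has property $(Z_{E_a})$,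 then the following statements are equivalent: (i) $T+R$ has property $(Z_{E_a})$; (ii) $E_a(T+R)=\Pi^0(T+R)$; (iii) $E_a(T+R)\cap\sigma(T)\subset\Pi^0(T)$. -/

import Mathlib

namespace WeylType

variable {X : Type*} [NormedAddCommGroup X] [NormedSpace ℂ X]

/-- The operator `T - μ I`. -/
noncomputable def shift (T : X →L[ℂ] X) (μ : ℂ) : X →L[ℂ] X :=
  T - μ • ContinuousLinearMap.id ℂ X

/-- The Fredholm index: dimension of the null space minus codimension of the range
(for a Fredholm operator, whose range is closed, the latter is the dimension of the null space
of the dual operator). Only used for Fredholm operators. -/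
noncomputable def index (T : X →L[ℂ] X) : ℤ :=
  (Module.finrank ℂ T.ker : ℤ) - (Module.finrank ℂ (X ⧸ T.range) : ℤ)

/-- Weyl operators: Fredholm operators of index `0`. -/
def IsWeyl (T : X →L[ℂ] X) : Prop :=
  T.IsFredholm ∧ index T = 0

/-- The Weyl spectrum. -/
def weylSpectrum (T : X →L[ℂ] X) : Set ℂ :=
  {μ | ¬ IsWeyl (shift T μ)}

/-- Riesz operators: `R - μ I` is Fredholm for every nonzero complex `μ`. -/
def IsRiesz (R : X →L[ℂ] X) : Prop :=
  ∀ μ : ℂ, μ ≠ 0 → (shift R μ).IsFredholm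

/-- `T` is bounded below. -/
def IsBoundedBelow (T : X →L[ℂ] X) : Prop :=
  ∃ c : ℝ, 0 < c ∧ ∀ x : X, c * ‖x‖ ≤ ‖T x‖

/-- The approximate point spectrum. -/
def approxPointSpectrum (T : X →L[ℂ] X) : Set ℂ :=
  {μ | ¬ IsBoundedBelow (shift T μ)}

/-- The set of eigenvalues. -/
def pointSpectrum (T : X →L[ℂ] X) : Set ℂ :=
  {μ | Module.End.HasEigenvalue (T : Module.End ℂ X) μ}

/-- The isolated points of a set of complex numbers. -/
def iso (A : Set ℂ) : Set ℂ :=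
  {μ | μ ∈ A ∧ ¬ AccPt μ (Filter.principal A)}

/-- `E_a(T)`: the eigenvalues of `T` that are isolated in the approximate point spectrum. -/
def Ea (T : X →L[ℂ] X) : Set ℂ :=
  iso (approxPointSpectrum T) ∩ pointSpectrum T

/-- `T` has finite ascent. -/
def HasFiniteAscent (T : X →L[ℂ] X) : Prop :=
  ∃ n : ℕ, (T ^ n).ker = (T ^ (n + 1)).ker

/-- `T` has finite descent. -/
def HasFiniteDescent (T : X →L[ℂ] X) : Prop :=
  ∃ n : ℕ, (T ^ n).range = (T ^ (n + 1)).range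

/-- The poles of the resolvent of `T`. -/
def poles (T : X →L[ℂ] X) : Set ℂ :=
  {μ | μ ∈ spectrum ℂ T ∧ HasFiniteAscent (shift T μ) ∧ HasFiniteDescent (shift T μ)}

/-- The poles of finite rank. The rank of a pole `μ` is the dimension of the range of its spectral
projection, that is, of the generalized eigenspace `⋃ n, ker (T - μ I) ^ n`. -/
def polesFiniteRank (T : X →L[ℂ] X) : Set ℂ :=
  {μ | μ ∈ poles T ∧
    FiniteDimensional ℂ (Module.End.maxGenEigenspace (T : Module.End ℂ X) μ)}

/-- Property `(Z_{E_a})`. -/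
def PropertyZEa (T : X →L[ℂ] X) : Prop :=
  spectrum ℂ T \ weylSpectrum T = Ea T

end WeylType

/-! Call an operator Browder if it is Weyl with finite ascent; it then has finite descent too, and
the poles of finite rank of an operator are the points of its spectrum where the shift is Browder.
Everything rests on two facts. First, a commuting Riesz perturbation preserves Weyl operators
(`IsWeyl.add_riesz`) and Browder operators (`IsBrowder.add_riesz`). Second, if a Weyl shift sits at
an isolated point of the approximate point spectrum, nearby shifts are injective, and this forces
finite ascent (`hasFiniteAscent_of_frequently_injective`).

By the second fact, property $(Z_{E_a})$ makes every Weyl shift of `T` Browder; by the first, the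
same holds for `T + R`. Hence the left side of $(Z_{E_a})$ for `T + R` is its set of poles of finite
rank, which gives (i) ⇔ (ii). Such poles always lie in `Ea`, so (ii) only asks that shifts of `T +
R` at points of `Ea (T + R)` be Browder. This can be tested on `T`: off its spectrum it is
automatic, and on it this is (iii).

The perturbation results use that `R` is quasinilpotent modulo the closure of the finite rank
operators. -/

section NormedQuotient

/-! ### Normed algebra structure on quotients. -/

/-- The quotient of a normed ring by a closed two-sided ideal is a normed ring. -/
noncomputable abbrev Ideal.quotientNormedRing {A : Type*} [NormedRing A] (I : Ideal A)
    [I.IsTwoSided] [IsClosed (I : Set A)] : NormedRing (A ⧸ I) where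
  __ := Ideal.Quotient.ring I
  __ := Submodule.Quotient.normedAddCommGroup I
  norm_mul_le x y := by
    refine le_of_forall_pos_le_add fun ε hε => ?_
    have key : ∀ δ > 0, ‖x * y‖ ≤ (‖x‖ + δ) * (‖y‖ + δ) := fun δ hδ => by
      obtain ⟨a, ha, ha'⟩ := Submodule.Quotient.norm_mk_lt x hδ
      obtain ⟨b, hb, hb'⟩ := Submodule.Quotient.norm_mk_lt y hδ
      have h1 : x * y = Submodule.Quotient.mk (a * b) := by rw [← ha, ← hb]; rfl
      have h2 : ‖(Submodule.Quotient.mk (a * b) : A ⧸ I)‖ ≤ ‖a * b‖ :=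
        Submodule.Quotient.norm_mk_le I (a * b)
      rw [h1]
      exact h2.trans ((norm_mul_le a b).trans (by gcongr))
    have hlim : Filter.Tendsto (fun δ : ℝ => (‖x‖ + δ) * (‖y‖ + δ)) (nhdsWithin 0 (Set.Ioi 0))
        (nhds (‖x‖ * ‖y‖)) := by
      have : Continuous fun δ : ℝ => (‖x‖ + δ) * (‖y‖ + δ) := by fun_prop
      simpa using (this.tendsto 0).mono_left nhdsWithin_le_nhds
    have hle := ge_of_tendsto hlim (Filter.eventually_of_mem self_mem_nhdsWithin key)
    linarith

/-- The quotient of a normed algebra by a closed two-sided ideal is a normed algebra. -/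
noncomputable abbrev Ideal.quotientNormedAlgebra (𝕜 : Type*) {A : Type*} [NormedField 𝕜]
    [NormedRing A] [NormedAlgebra 𝕜 A] (I : Ideal A) [I.IsTwoSided] [IsClosed (I : Set A)] :
    letI := I.quotientNormedRing
    NormedAlgebra 𝕜 (A ⧸ I) :=
  letI := I.quotientNormedRing
  { Ideal.Quotient.algebra 𝕜 (I := I) with
    norm_smul_le := (Submodule.Quotient.normedSpace I 𝕜).norm_smul_le }

end NormedQuotient

theorem isUnit_of_isUnit_mul_of_isUnit_mul {M : Type*} [Monoid M] {a b c : M}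
    (hab : IsUnit (a * b)) (hca : IsUnit (c * a)) : IsUnit a := by
  obtain ⟨u, hu⟩ := hab
  obtain ⟨v, hv⟩ := hca
  refine isUnit_iff_exists_and_exists.2 ⟨⟨b * ↑u⁻¹, ?_⟩, ⟨↑v⁻¹ * c, ?_⟩⟩
  · rw [← mul_assoc, ← hu, Units.mul_inv]
  · rw [mul_assoc, ← hv, Units.inv_mul]

/-! ### Fredholm operators modulo finite rank, and the index. -/

namespace WeylType

open LinearMap.FiniteRangeSetoid

variable {E : Type*} [NormedAddCommGroup E] [NormedSpace ℂ E]

/-- The two-sided ideal of finite rank operators. -/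
def finiteRankIdeal (E : Type*) [NormedAddCommGroup E] [NormedSpace ℂ E] :
    Ideal (E →L[ℂ] E) where
  carrier := {T | (T : E →ₗ[ℂ] E).HasNoetherianRange}
  add_mem' hS hT := hS.add hT
  zero_mem' := LinearMap.HasNoetherianRange.zero
  smul_mem' S _ hT := hT.comp_left (S : E →ₗ[ℂ] E)

theorem mem_finiteRankIdeal {T : E →L[ℂ] E} :
    T ∈ finiteRankIdeal E ↔ (T : E →ₗ[ℂ] E).HasNoetherianRange := Iff.rfl

instance : (finiteRankIdeal E).IsTwoSided where
  mul_mem_of_left {_} S hT := LinearMap.HasNoetherianRange.comp_right hT (S : E →ₗ[ℂ] E)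

/-- A quasi-inverse is an inverse modulo finite rank, so products, powers and finite rank
perturbations become algebra in the quotient. -/
theorem isFredholm_iff_isUnit_mk {T : E →L[ℂ] E} :
    T.IsFredholm ↔ IsUnit (Ideal.Quotient.mk (finiteRankIdeal E) T) := by
  have key : ∀ S T : E →L[ℂ] E, (S : E →ₗ[ℂ] E) ∘ₗ (T : E →ₗ[ℂ] E) ≈ LinearMap.id ↔
      Ideal.Quotient.mk (finiteRankIdeal E) S * Ideal.Quotient.mk (finiteRankIdeal E) T = 1 := by
    intro S T
    rw [equiv_iff_hasNoetherianRange, ← map_mul, ← map_one (Ideal.Quotient.mk _),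
      Ideal.Quotient.mk_eq_mk_iff_sub_mem, mem_finiteRankIdeal]
    rfl
  rw [ContinuousLinearMap.isFredholm_iff_exists_isQuasiInverse, isUnit_iff_exists]
  constructor
  · rintro ⟨S, hl, hr⟩
    exact ⟨Ideal.Quotient.mk _ S, (key _ _).1 hr, (key _ _).1 hl⟩
  · rintro ⟨s, hr, hl⟩
    obtain ⟨S, rfl⟩ := Ideal.Quotient.mk_surjective s
    exact ⟨S, (key _ _).2 hl, (key _ _).2 hr⟩

theorem _root_.ContinuousLinearMap.IsFredholm.finiteDimensional_quotient {T : E →L[ℂ] E}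
    (hT : T.IsFredholm) : FiniteDimensional ℂ (E ⧸ T.range) := hT.finite_coker

theorem isFredholm_of_isUnit {T : E →L[ℂ] E} (hT : IsUnit T) : T.IsFredholm :=
  isFredholm_iff_isUnit_mk.2 (hT.map _)

theorem _root_.ContinuousLinearMap.IsFredholm.mul {S T : E →L[ℂ] E} (hS : S.IsFredholm)
    (hT : T.IsFredholm) : (S * T).IsFredholm := by
  rw [isFredholm_iff_isUnit_mk] at *
  rw [map_mul]
  exact hS.mul hT

theorem _root_.ContinuousLinearMap.IsFredholm.pow {T : E →L[ℂ] E} (hT : T.IsFredholm) (n : ℕ) :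
    (T ^ n).IsFredholm := by
  rw [isFredholm_iff_isUnit_mk] at *
  rw [map_pow]
  exact IsUnit.pow n hT

theorem isFredholm_add_finiteRank_iff {T F : E →L[ℂ] E} (hF : F ∈ finiteRankIdeal E) :
    (T + F).IsFredholm ↔ T.IsFredholm := by
  rw [isFredholm_iff_isUnit_mk, isFredholm_iff_isUnit_mk, map_add,
    Ideal.Quotient.eq_zero_iff_mem.2 hF, add_zero]

theorem index_mul {S T : E →L[ℂ] E} (hS : S.IsFredholm) (hT : T.IsFredholm) :
    index (S * T) = index S + index T := by
  have := hS.finite_ker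
  have := hT.finite_ker
  have := hS.finiteDimensional_quotient
  have := hT.finiteDimensional_quotient
  exact LinearMap.index_comp (f := (T : E →ₗ[ℂ] E)) (S : E →ₗ[ℂ] E)

theorem index_eq_zero_of_isUnit {T : E →L[ℂ] E} (hT : IsUnit T) : index T = 0 := by
  obtain ⟨u, rfl⟩ := hT
  exact LinearEquiv.index_eq_zero (e := (ContinuousLinearEquiv.ofUnit u).toLinearEquiv)

theorem index_pow {T : E →L[ℂ] E} (hT : T.IsFredholm) (n : ℕ) : index (T ^ n) = n * index T := by
  induction n with
  | zero => simp [index_eq_zero_of_isUnit]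
  | succ n ih => rw [pow_succ, index_mul (hT.pow n) hT, ih]; push_cast; ring

/-- `T + F` and `T` agree on `F.ker`, whose inclusion `j` has finite index; additivity of the index
lets `index j` cancel. -/
theorem index_add_finiteRank {T F : E →L[ℂ] E} (hT : T.IsFredholm)
    (hF : F ∈ finiteRankIdeal E) : index (T + F) = index T := by
  have hTF := (isFredholm_add_finiteRank_iff (T := T) hF).2 hT
  have := hT.finite_ker
  have := hTF.finite_ker
  have := hT.finiteDimensional_quotient
  have := hTF.finiteDimensional_quotient
  have hq : IsNoetherian ℂ (E ⧸ (F : E →ₗ[ℂ] E).ker) := hF.quotient_ker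
  let j : F.ker →ₗ[ℂ] E := F.ker.subtype
  have hj : FiniteDimensional ℂ j.ker := by
    rw [Submodule.ker_subtype]; infer_instance
  have hj' : FiniteDimensional ℂ (E ⧸ j.range) := by
    rw [Submodule.range_subtype]; infer_instance
  have h : ((T + F : E →L[ℂ] E) : E →ₗ[ℂ] E) ∘ₗ j = (T : E →ₗ[ℂ] E) ∘ₗ j := by
    ext x
    simp [j]
  have h1 := LinearMap.index_comp (f := j) ((T + F : E →L[ℂ] E) : E →ₗ[ℂ] E)
  have h2 := LinearMap.index_comp (f := j) (T : E →ₗ[ℂ] E)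
  rw [h, h2] at h1
  exact (add_right_cancel h1).symm

theorem index_eq_zero_iff_surjective_of_injective {T : E →L[ℂ] E} (hT : T.IsFredholm)
    (hinj : Function.Injective T) : index T = 0 ↔ Function.Surjective T := by
  have := hT.finiteDimensional_quotient
  have hk : index T = - (Module.finrank ℂ (E ⧸ T.range) : ℤ) :=
    LinearMap.index_of_injective (f := (T : E →ₗ[ℂ] E)) hinj
  rw [hk, neg_eq_zero, Nat.cast_eq_zero, Module.finrank_eq_zero_iff_of_free,
    Submodule.Quotient.subsingleton_iff]
  exact LinearMap.range_eq_top

section Complete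

variable [CompleteSpace E]

theorem isUnit_of_injective_of_index_eq_zero {T : E →L[ℂ] E} (hT : T.IsFredholm)
    (hinj : Function.Injective T) (h : index T = 0) : IsUnit T :=
  ContinuousLinearMap.isUnit_iff_bijective.2
    ⟨hinj, (index_eq_zero_iff_surjective_of_injective hT hinj).1 h⟩

/-- The Fredholm property and the index are stable under small perturbations. -/
theorem eventually_isFredholm_index_eq {T : E →L[ℂ] E} (hT : T.IsFredholm) :
    ∀ᶠ S in nhds T, S.IsFredholm ∧ index S = index T := by
  obtain ⟨t, ht⟩ := isFredholm_iff_isUnit_mk.1 hT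
  obtain ⟨V, hV⟩ := Ideal.Quotient.mk_surjective (t⁻¹ : (_ ⧸ finiteRankIdeal E)ˣ).val
  have hVF : V.IsFredholm := isFredholm_iff_isUnit_mk.2 (by rw [hV]; exact Units.isUnit _)
  have h1 : V * T - 1 ∈ finiteRankIdeal E := by
    rw [← Ideal.Quotient.mk_eq_mk_iff_sub_mem, map_mul, map_one, hV, ← ht, Units.inv_mul]
  have h2 : T * V - 1 ∈ finiteRankIdeal E := by
    rw [← Ideal.Quotient.mk_eq_mk_iff_sub_mem, map_mul, map_one, hV, ← ht, Units.mul_inv]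
  have hVT : index V + index T = 0 := by
    rw [← index_mul hVF hT, ← index_eq_zero_of_isUnit (isUnit_one (M := E →L[ℂ] E)),
      ← index_add_finiteRank (isFredholm_of_isUnit isUnit_one) h1]
    congr 1; abel
  -- With `V` inverting `T` modulo finite rank, `V * S` and `S * V` are units plus finite rank for
  -- `S` near `T`.
  have hu1 : ∀ᶠ S in nhds T, IsUnit (1 + V * (S - T)) := by
    have hc : Continuous fun S : E →L[ℂ] E => 1 + V * (S - T) := by fun_prop
    exact hc.continuousAt.eventually_mem
      (Units.isOpen.mem_nhds (by simp : IsUnit (1 + V * (T - T))))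
  have hu2 : ∀ᶠ S in nhds T, IsUnit (1 + (S - T) * V) := by
    have hc : Continuous fun S : E →L[ℂ] E => 1 + (S - T) * V := by fun_prop
    exact hc.continuousAt.eventually_mem
      (Units.isOpen.mem_nhds (by simp : IsUnit (1 + (T - T) * V)))
  filter_upwards [hu1, hu2] with S hS1 hS2
  have e1 : V * S = (1 + V * (S - T)) + (V * T - 1) := by rw [mul_sub]; abel
  have e2 : S * V = (1 + (S - T) * V) + (T * V - 1) := by rw [sub_mul]; abel
  have hF1 : (V * S).IsFredholm := by
    rw [e1, isFredholm_add_finiteRank_iff h1]; exact isFredholm_of_isUnit hS1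
  have hF2 : (S * V).IsFredholm := by
    rw [e2, isFredholm_add_finiteRank_iff h2]; exact isFredholm_of_isUnit hS2
  have hS : S.IsFredholm := by
    rw [isFredholm_iff_isUnit_mk, map_mul] at hF1 hF2
    exact isFredholm_iff_isUnit_mk.2 (isUnit_of_isUnit_mul_of_isUnit_mul hF2 hF1)
  refine ⟨hS, ?_⟩
  have : index V + index S = 0 := by
    rw [← index_mul hVF hS, e1, index_add_finiteRank (isFredholm_of_isUnit hS1) h1,
      index_eq_zero_of_isUnit hS1]
  omega

end Complete

end WeylType
-- Atkinson's theorem and Riesz perturbation of Weyl operators.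
namespace WeylType

section Essential

variable {E : Type*} [NormedAddCommGroup E] [NormedSpace ℂ E]

instance : (finiteRankIdeal E).closure.IsTwoSided where
  mul_mem_of_left {_} S hT :=
    map_mem_closure (f := fun T => T * S) (continuous_mul_const S) hT
      fun _ hT => Ideal.mul_mem_right S _ hT

instance : IsClosed ((finiteRankIdeal E).closure : Set (E →L[ℂ] E)) := isClosed_closure

/-- The quotient of the algebra of bounded operators by the closure of the finite rank operators. -/
abbrev EssentialAlgebra (E : Type*) [NormedAddCommGroup E] [NormedSpace ℂ E] : Type _ :=
  (E →L[ℂ] E) ⧸ (finiteRankIdeal E).closure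

noncomputable instance : NormedRing (EssentialAlgebra E) :=
  (finiteRankIdeal E).closure.quotientNormedRing

noncomputable instance : NormedAlgebra ℂ (EssentialAlgebra E) :=
  (finiteRankIdeal E).closure.quotientNormedAlgebra ℂ

/-- The quotient map onto the essential algebra. -/
noncomputable abbrev toEssential (E : Type*) [NormedAddCommGroup E] [NormedSpace ℂ E] :
    (E →L[ℂ] E) →ₐ[ℂ] EssentialAlgebra E :=
  Ideal.Quotient.mkₐ ℂ (finiteRankIdeal E).closure

theorem toEssential_surjective : Function.Surjective (toEssential E) :=
  Ideal.Quotient.mk_surjective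

theorem toEssential_eq_iff {S T : E →L[ℂ] E} :
    toEssential E S = toEssential E T ↔ S - T ∈ (finiteRankIdeal E).closure :=
  Ideal.Quotient.mk_eq_mk_iff_sub_mem S T

theorem IsRiesz.smul {R : E →L[ℂ] E} (hR : IsRiesz R) (c : ℂ) : IsRiesz (c • R) := by
  intro μ hμ
  rcases eq_or_ne c 0 with rfl | hc
  · refine isFredholm_of_isUnit ?_
    have : shift ((0 : ℂ) • R) μ = algebraMap ℂ (E →L[ℂ] E) (-μ) := by
      rw [shift, zero_smul, zero_sub, Algebra.algebraMap_eq_smul_one, neg_smul]; rfl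
    rw [this]
    exact (IsUnit.mk0 (-μ) (neg_ne_zero.2 hμ)).map _
  · have h := hR (c⁻¹ * μ) (mul_ne_zero (inv_ne_zero hc) hμ)
    rw [isFredholm_iff_isUnit_mk] at h ⊢
    have : shift (c • R) μ = algebraMap ℂ (E →L[ℂ] E) c * shift R (c⁻¹ * μ) := by
      rw [shift, shift, ← Algebra.smul_def, smul_sub, smul_smul, mul_inv_cancel_left₀ hc]
    rw [this, map_mul]
    exact (((IsUnit.mk0 c hc).map _).map _).mul h

theorem IsRiesz.add_finiteRank {R F : E →L[ℂ] E} (hR : IsRiesz R) (hF : F ∈ finiteRankIdeal E) :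
    IsRiesz (R + F) := by
  intro μ hμ
  have : shift (R + F) μ = shift R μ + F := by rw [shift, shift]; abel
  rw [this, isFredholm_add_finiteRank_iff hF]
  exact hR μ hμ

theorem IsWeyl.add_finiteRank {T F : E →L[ℂ] E} (hT : IsWeyl T) (hF : F ∈ finiteRankIdeal E) :
    IsWeyl (T + F) :=
  ⟨(isFredholm_add_finiteRank_iff hF).2 hT.1, (index_add_finiteRank hT.1 hF).trans hT.2⟩

theorem isWeyl_of_isUnit {T : E →L[ℂ] E} (hT : IsUnit T) : IsWeyl T :=
  ⟨isFredholm_of_isUnit hT, index_eq_zero_of_isUnit hT⟩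

variable [CompleteSpace E]

theorem isFredholm_of_sub_one_mem_closure {T : E →L[ℂ] E}
    (hT : T - 1 ∈ (finiteRankIdeal E).closure) : T.IsFredholm := by
  obtain ⟨F, hF, hd⟩ := Metric.mem_closure_iff.1 hT 1 one_pos
  have hu : IsUnit (T - F) := by
    have := isUnit_one_sub_of_norm_lt_one (x := -(T - 1 - F)) (by rwa [norm_neg, ← dist_eq_norm])
    convert this using 1
    abel
  rw [← sub_add_cancel T F, isFredholm_add_finiteRank_iff hF]
  exact isFredholm_of_isUnit hu

/-- Atkinson's theorem. -/
theorem isFredholm_iff_isUnit_toEssential {T : E →L[ℂ] E} :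
    T.IsFredholm ↔ IsUnit (toEssential E T) := by
  constructor
  · intro hT
    rw [isFredholm_iff_isUnit_mk, isUnit_iff_exists] at hT
    obtain ⟨s, hr, hl⟩ := hT
    obtain ⟨S, rfl⟩ := Ideal.Quotient.mk_surjective s
    rw [← map_mul, ← map_one (Ideal.Quotient.mk _), Ideal.Quotient.mk_eq_mk_iff_sub_mem] at hl hr
    refine isUnit_iff_exists.2 ⟨toEssential E S, ?_, ?_⟩ <;>
      rw [← map_mul, ← map_one (toEssential E), toEssential_eq_iff]
    exacts [subset_closure hr, subset_closure hl]
  · intro hT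
    obtain ⟨s, hr, hl⟩ := isUnit_iff_exists.1 hT
    obtain ⟨S, rfl⟩ := toEssential_surjective s
    rw [← map_mul, ← map_one (toEssential E), toEssential_eq_iff] at hl hr
    have h1 := isFredholm_iff_isUnit_mk.1 (isFredholm_of_sub_one_mem_closure hl)
    have h2 := isFredholm_iff_isUnit_mk.1 (isFredholm_of_sub_one_mem_closure hr)
    rw [map_mul] at h1 h2
    exact isFredholm_iff_isUnit_mk.2 (isUnit_of_isUnit_mul_of_isUnit_mul h2 h1)

theorem spectrum_toEssential_subset_of_isRiesz {R : E →L[ℂ] E} (hR : IsRiesz R) :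
    spectrum ℂ (toEssential E R) ⊆ {0} := by
  intro μ hμ
  by_contra h
  refine hμ ?_
  have := isFredholm_iff_isUnit_toEssential.1 (hR μ h)
  rw [spectrum.mem_resolventSet_iff, ← IsUnit.neg_iff]
  convert this using 1
  rw [shift, map_sub, map_smul, Algebra.algebraMap_eq_smul_one, neg_sub]
  rfl

theorem exists_norm_pow_lt_of_spectrum_subset {A : Type*} [NormedRing A] [NormedAlgebra ℂ A]
    [CompleteSpace A] {a : A} (ha : spectrum ℂ a ⊆ {0}) {ε : ℝ} (hε : 0 < ε) :
    ∃ n : ℕ, n ≠ 0 ∧ ‖a ^ n‖ < ε ^ n := by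
  have h0 : spectralRadius ℂ a = 0 := by
    rw [spectralRadius]
    simp only [ENNReal.iSup_eq_zero]
    intro k hk
    simp [Set.mem_singleton_iff.1 (ha hk)]
  have h := spectrum.pow_norm_pow_one_div_tendsto_nhds_spectralRadius a
  rw [h0] at h
  have h' := h.eventually_lt_const (ENNReal.ofReal_pos.2 hε)
  obtain ⟨n, hn, hn0⟩ := (h'.and (Filter.eventually_ne_atTop 0)).exists
  refine ⟨n, hn0, ?_⟩
  rw [ENNReal.ofReal_lt_ofReal_iff hε] at hn
  have h2 : (‖a ^ n‖ ^ (1 / n : ℝ)) ^ n = ‖a ^ n‖ := by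
    rw [one_div, Real.rpow_inv_natCast_pow (norm_nonneg _) hn0]
  rw [← h2]
  exact pow_lt_pow_left₀ hn (by positivity) hn0

/-- Riesz operators are quasinilpotent modulo operators of finite rank. -/
theorem exists_norm_pow_sub_finiteRank_lt {R : E →L[ℂ] E} (hR : IsRiesz R) {ε : ℝ} (hε : 0 < ε) :
    ∃ n : ℕ, n ≠ 0 ∧ ∃ F ∈ finiteRankIdeal E, ‖R ^ n - F‖ < ε ^ n := by
  obtain ⟨n, hn, h⟩ := exists_norm_pow_lt_of_spectrum_subset
    (spectrum_toEssential_subset_of_isRiesz hR) hε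
  refine ⟨n, hn, ?_⟩
  -- A representative `S` of the class of `R ^ n` still has norm below `ε ^ n`; the slack `ε ^ n -
  -- ‖S‖` pays for replacing `R ^ n - S` by a genuine finite rank operator.
  obtain ⟨S, hS, hS'⟩ := Submodule.Quotient.norm_mk_lt (toEssential E R ^ n) (sub_pos.2 h)
  have hS'' : R ^ n - S ∈ (finiteRankIdeal E).closure := by
    rw [← toEssential_eq_iff, map_pow]
    exact hS.symm
  obtain ⟨F, hF, hd⟩ := Metric.mem_closure_iff.1 hS'' (ε ^ n - ‖S‖) (by linarith)
  refine ⟨F, hF, ?_⟩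
  rw [dist_eq_norm] at hd
  calc ‖R ^ n - F‖ = ‖(R ^ n - S - F) + S‖ := by congr 1; abel
    _ ≤ ‖R ^ n - S - F‖ + ‖S‖ := norm_add_le _ _
    _ < ε ^ n := by linarith

/-- Factor `u + r = u * (1 - q)` with `q = -(u⁻¹ * r)`. By commutation some power `q ^ n` has norm
below one, and `1 - q` divides the unit `1 - q ^ n` on both sides. -/
theorem isUnit_add_of_spectrum_subset {A : Type*} [NormedRing A] [NormedAlgebra ℂ A]
    [CompleteSpace A] {a r : A} (ha : IsUnit a) (har : Commute a r) (hr : spectrum ℂ r ⊆ {0}) :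
    IsUnit (a + r) := by
  obtain ⟨u, rfl⟩ := ha
  have hc : Commute (↑u⁻¹ : A) r := har.units_inv_left
  obtain ⟨n, hn, h⟩ := exists_norm_pow_lt_of_spectrum_subset hr
    (ε := (‖(↑u⁻¹ : A)‖ + 1)⁻¹) (by positivity)
  have hlt : ‖((-(↑u⁻¹ * r)) ^ n : A)‖ < 1 := by
    rw [← mul_neg, (hc.neg_right).mul_pow]
    calc ‖(↑u⁻¹ : A) ^ n * (-r) ^ n‖ ≤ ‖(↑u⁻¹ : A) ^ n‖ * ‖(-r) ^ n‖ := norm_mul_le _ _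
      _ = ‖(↑u⁻¹ : A) ^ n‖ * ‖r ^ n‖ := by
        rw [neg_pow]
        rcases neg_one_pow_eq_or A n with h | h <;> simp [h]
      _ ≤ (‖(↑u⁻¹ : A)‖ + 1) ^ n * ‖r ^ n‖ := by
        gcongr
        exact (norm_pow_le' _ (Nat.pos_of_ne_zero hn)).trans (by gcongr; linarith)
      _ < (‖(↑u⁻¹ : A)‖ + 1) ^ n * ((‖(↑u⁻¹ : A)‖ + 1)⁻¹) ^ n := by gcongr
      _ = 1 := by rw [← mul_pow, mul_inv_cancel₀ (by positivity), one_pow]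
  have hu := isUnit_one_sub_of_norm_lt_one hlt
  have hg := (Commute.one_left (-(↑u⁻¹ * r) : A)).mul_geom_sum₂ n
  have hg' := (Commute.one_left (-(↑u⁻¹ * r) : A)).geom_sum₂_mul n
  rw [one_pow] at hg hg'
  have h1 : IsUnit (1 - -(↑u⁻¹ * r) : A) :=
    isUnit_of_isUnit_mul_of_isUnit_mul (hg ▸ hu) (hg' ▸ hu)
  have h2 : (u : A) + r = u * (1 - -(↑u⁻¹ * r)) := by
    rw [sub_neg_eq_add, mul_add, mul_one, Units.mul_inv_cancel_left]
  rw [h2]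
  exact u.isUnit.mul h1

theorem isFredholm_add_riesz {T R : E →L[ℂ] E} (hT : T.IsFredholm) (hR : IsRiesz R)
    (hTR : Commute T R) : (T + R).IsFredholm := by
  rw [isFredholm_iff_isUnit_toEssential] at hT ⊢
  rw [map_add]
  exact isUnit_add_of_spectrum_subset hT (hTR.map _) (spectrum_toEssential_subset_of_isRiesz hR)

/-- The path `T + c • R` stays Fredholm, and a locally constant index on the connected plane is
constant. -/
theorem index_add_riesz {T R : E →L[ℂ] E} (hT : T.IsFredholm) (hR : IsRiesz R)
    (hTR : Commute T R) : index (T + R) = index T := by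
  have hF : ∀ c : ℂ, (T + c • R).IsFredholm := fun c =>
    isFredholm_add_riesz hT (hR.smul c) (hTR.smul_right c)
  have hl : IsLocallyConstant fun c : ℂ => index (T + c • R) := by
    rw [IsLocallyConstant.iff_eventually_eq]
    intro c
    have hc : Continuous fun c : ℂ => T + c • R := by fun_prop
    exact (hc.continuousAt.eventually (eventually_isFredholm_index_eq (hF c))).mono fun _ h => h.2
  simpa using hl.apply_eq_of_preconnectedSpace 1 0

theorem IsWeyl.add_riesz {T R : E →L[ℂ] E} (hT : IsWeyl T) (hR : IsRiesz R)
    (hTR : Commute T R) : IsWeyl (T + R) :=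
  ⟨isFredholm_add_riesz hT.1 hR hTR, (index_add_riesz hT.1 hR hTR).trans hT.2⟩

end Essential

end WeylType
-- Browder operators and their spectral projections.
namespace WeylType

section Browder

variable {E : Type*} [NormedAddCommGroup E] [NormedSpace ℂ E]

theorem mem_ker_pow_add_of_ker_pow_eq {T : E →L[ℂ] E} {n : ℕ}
    (h : (T ^ n).ker = (T ^ (n + 1)).ker) (k : ℕ) {x : E} (hx : (T ^ (n + k)) x = 0) :
    (T ^ n) x = 0 := by
  have := Module.End.ker_pow_constant (f := (T : Module.End ℂ E)) (k := n)
    (by simpa only [ContinuousLinearMap.toLinearMap_pow] using h) k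
  rw [← ContinuousLinearMap.toLinearMap_pow, ← ContinuousLinearMap.toLinearMap_pow] at this
  have hx' : x ∈ (T ^ (n + k)).ker := hx
  rw [← this] at hx'
  exact hx'

theorem exists_pow_add_eq_of_range_pow_eq {T : E →L[ℂ] E} {n : ℕ}
    (h : (T ^ n).range = (T ^ (n + 1)).range) (k : ℕ) (x : E) :
    ∃ y, (T ^ (n + k)) y = (T ^ n) x := by
  induction k with
  | zero => exact ⟨x, rfl⟩
  | succ k ih =>
    obtain ⟨y, hy⟩ := ih
    have : (T ^ n) y ∈ (T ^ (n + 1)).range := h ▸ ⟨y, rfl⟩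
    obtain ⟨z, hz⟩ := this
    refine ⟨z, ?_⟩
    rw [← hy, add_comm n k, pow_add T k n, mul_apply_eq_comp, ← hz,
      show n + (k + 1) = k + (n + 1) by ring, pow_add T k (n + 1)]
    rfl

/-- Restricting `S` to a closed complement of its kernel gives an injective operator with the same
range, which has a closed algebraic complement. -/
theorem isClosed_range_of_isCompl_ker [CompleteSpace E] {S : E →L[ℂ] E}
    (hfin : FiniteDimensional ℂ S.ker) (h : IsCompl S.ker S.range) :
    IsClosed (S.range : Set E) := by
  obtain ⟨M, hM, hKM⟩ :=
    (Submodule.ClosedComplemented.of_finiteDimensional S.ker).exists_isClosed_isCompl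
  have : CompleteSpace M := hM.completeSpace_coe
  let f : M →L[ℂ] E := S ∘L M.subtypeL
  have hr : f.range = S.range := by
    refine le_antisymm ?_ ?_
    · rintro _ ⟨x, rfl⟩
      exact ⟨x, rfl⟩
    · rintro _ ⟨x, rfl⟩
      obtain ⟨k, hk, m, hm, rfl⟩ := Submodule.mem_sup.1
        ((hKM.sup_eq_top ▸ Submodule.mem_top : x ∈ S.ker ⊔ M))
      refine ⟨⟨m, hm⟩, ?_⟩
      have hk' : S k = 0 := hk
      change S m = S (k + m)
      rw [map_add, hk', zero_add]
  have hk : f.ker = ⊥ := by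
    rw [LinearMap.ker_eq_bot']
    intro m hm
    have : (m : E) ∈ S.ker ⊓ M := ⟨hm, m.2⟩
    rw [hKM.inf_eq_bot] at this
    exact Subtype.ext this
  have hc : IsCompl f.range S.ker := by rw [hr]; exact h.symm
  rw [← hr]
  exact f.closed_complemented_range_of_isCompl_of_ker_eq_bot S.ker hc
    (Submodule.closed_of_finiteDimensional _) hk

/-- If `T` has finite ascent and descent and finite-dimensional generalized kernel, then the
spectral projection at `0` is a finite rank projection in the double commutant of `T` whose
addition makes `T` invertible. -/
theorem exists_projection_of_ascent_descent [CompleteSpace E] {T : E →L[ℂ] E}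
    (ha : HasFiniteAscent T) (hd : HasFiniteDescent T)
    (hfin : ∀ n, FiniteDimensional ℂ (T ^ n).ker) :
    ∃ P ∈ finiteRankIdeal E, (∀ S, Commute T S → Commute P S) ∧ (∃ n, T ^ n * P = 0) ∧
      IsUnit (T + P) := by
  obtain ⟨a, ha⟩ := ha
  obtain ⟨d, hd⟩ := hd
  obtain ⟨n, hna, hnd⟩ : ∃ n, a ≤ n ∧ d ≤ n := ⟨max a d, le_max_left _ _, le_max_right _ _⟩
  have hker : ∀ k x, (T ^ (n + k)) x = 0 → (T ^ n) x = 0 := by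
    intro k x hx
    obtain ⟨m, rfl⟩ := Nat.exists_eq_add_of_le hna
    have := mem_ker_pow_add_of_ker_pow_eq ha (m + k) (x := x) (by rwa [← add_assoc])
    rw [add_comm a m, pow_add, mul_apply_eq_comp, this, map_zero]
  have hran : ∀ k x, ∃ y, (T ^ (n + k)) y = (T ^ n) x := by
    intro k x
    obtain ⟨m, rfl⟩ := Nat.exists_eq_add_of_le hnd
    obtain ⟨y, hy⟩ := exists_pow_add_eq_of_range_pow_eq hd (m + k) ((T ^ m) x)
    refine ⟨y, ?_⟩
    rw [add_assoc, hy, pow_add T d m]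
    rfl
  have hcompl : IsCompl (T ^ n).ker (T ^ n).range := by
    refine ⟨?_, ?_⟩
    · rw [Submodule.disjoint_def]
      rintro _ hx ⟨y, rfl⟩
      refine hker n y ?_
      rw [pow_add]
      exact hx
    · rw [codisjoint_iff, Submodule.eq_top_iff']
      intro x
      obtain ⟨y, hy⟩ := hran n x
      refine Submodule.mem_sup.2 ⟨x - (T ^ n) y, ?_, (T ^ n) y, ⟨y, rfl⟩, sub_add_cancel _ _⟩
      change (T ^ n) (x - (T ^ n) y) = 0
      rw [map_sub, ← hy, pow_add]
      exact sub_self _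
  have hKfin := hfin n
  have htop := Submodule.IsCompl.isTopCompl_of_isClosed hcompl
    (Submodule.closed_of_finiteDimensional _) (isClosed_range_of_isCompl_ker hKfin hcompl)
  set P := (T ^ n).ker.projectionL (T ^ n).range htop with hP
  have hPl : ∀ x, (T ^ n) x = 0 → P x = x := fun x hx =>
    Submodule.projectionL_apply_left htop ⟨x, hx⟩
  have hPr : ∀ x, P ((T ^ n) x) = 0 := fun x =>
    Submodule.projectionL_apply_right htop ⟨(T ^ n) x, ⟨x, rfl⟩⟩
  have hPk : ∀ x, (T ^ n) (P x) = 0 := fun x => Submodule.projectionL_apply_mem htop x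
  have hdec : ∀ x, ∃ k y, (T ^ n) k = 0 ∧ x = k + (T ^ n) y := fun x => by
    obtain ⟨y, hy⟩ := hran n x
    refine ⟨x - (T ^ n) y, y, ?_, (sub_add_cancel _ _).symm⟩
    rw [map_sub, ← hy, pow_add]
    exact sub_self _
  have hcomm : ∀ S, Commute T S → Commute P S := by
    intro S hS
    have hS' : ∀ x, (T ^ n) (S x) = S ((T ^ n) x) := fun x =>
      congrArg (fun f : E →L[ℂ] E => f x) (hS.pow_left n).eq
    refine ContinuousLinearMap.ext fun x => ?_
    obtain ⟨k, y, hk, rfl⟩ := hdec x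
    change P (S (k + (T ^ n) y)) = S (P (k + (T ^ n) y))
    rw [map_add, map_add, map_add, map_add, hPl k hk, hPr, ← hS' y, hPr, hPl]
    · simp
    · rw [hS', hk, map_zero]
  refine ⟨P, ?_, hcomm, ⟨n, ContinuousLinearMap.ext hPk⟩, ?_⟩
  · rw [mem_finiteRankIdeal, LinearMap.hasNoetherianRange_iff_range]
    have : (P : E →ₗ[ℂ] E).range = (T ^ n).ker := Submodule.range_projectionL htop
    rw [this]
    infer_instance
  · have hPT : ∀ x, P (T x) = T (P x) := fun x =>
      congrArg (fun f : E →L[ℂ] E => f x) (hcomm T (Commute.refl T)).eq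
    have hPP : ∀ x, P (P x) = P x := fun x => hPl _ (hPk x)
    have hunip : ∀ x, T x + x = 0 → (T ^ n) x = 0 → x = 0 := by
      intro x hx hx'
      have h1 : ∀ m, (T ^ m) x = (-1 : ℂ) ^ m • x := by
        intro m
        induction m with
        | zero => simp
        | succ m ih =>
          rw [pow_succ', mul_apply_eq_comp, ih, map_smul,
            eq_neg_of_add_eq_zero_left hx, pow_succ, mul_smul, neg_one_smul]
      rw [h1] at hx'
      exact (smul_eq_zero.1 hx').resolve_left (pow_ne_zero _ (by norm_num))
    rw [ContinuousLinearMap.isUnit_iff_bijective]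
    constructor
    · rw [injective_iff_map_eq_zero]
      intro x hx
      have hx' : T x + P x = 0 := hx
      have h1 : T (P x) + P x = 0 := by
        have := congrArg P hx'
        rwa [map_add, hPP, hPT, map_zero] at this
      have h2 : P x = 0 := hunip _ h1 (hPk x)
      rw [h2, add_zero] at hx'
      have h3 : (T ^ n) x = 0 := by
        refine hker 1 x ?_
        rw [pow_succ, mul_apply_eq_comp, hx', map_zero]
      rw [← hPl x h3, h2]
    -- `T + P` is `T + 1` on the kernel of `T ^ n`, where injectivity gives surjectivity by finite
    -- dimension; on the range of `T ^ n` it is `T`, which is onto there by finite descent.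
    · let N : (T ^ n).ker →ₗ[ℂ] (T ^ n).ker :=
        ((T : E →ₗ[ℂ] E) + LinearMap.id).restrict (p := (T ^ n).ker) (q := (T ^ n).ker) (by
          intro x hx
          have hx' : (T ^ n) x = 0 := hx
          change (T ^ n) (T x + x) = 0
          rw [map_add, hx', add_zero, ← mul_apply_eq_comp, ← pow_succ, pow_succ',
            mul_apply_eq_comp, hx', map_zero])
      have hN : Function.Surjective N := by
        rw [← LinearMap.injective_iff_surjective, injective_iff_map_eq_zero]
        intro x hx
        exact Subtype.ext (hunip x (congrArg Subtype.val hx) x.2)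
      intro z
      obtain ⟨k, y, hk, rfl⟩ := hdec z
      obtain ⟨⟨w, hw⟩, hw'⟩ := hN ⟨k, hk⟩
      have hw1 : T w + w = k := congrArg Subtype.val hw'
      obtain ⟨v, hv⟩ := hran 1 y
      refine ⟨w + (T ^ n) v, ?_⟩
      change T (w + (T ^ n) v) + P (w + (T ^ n) v) = _
      rw [map_add, map_add, hPr, add_zero, hPl w hw, ← hv, ← hw1, pow_succ',
        mul_apply_eq_comp]
      abel

/-- Browder operators: Fredholm operators of index `0` with finite ascent. -/
def IsBrowder (T : E →L[ℂ] E) : Prop :=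
  IsWeyl T ∧ HasFiniteAscent T

theorem isBrowder_of_isUnit {T : E →L[ℂ] E} (hT : IsUnit T) : IsBrowder T := by
  refine ⟨isWeyl_of_isUnit hT, 0, ?_⟩
  obtain ⟨u, rfl⟩ := hT
  refine le_antisymm (fun x hx => ?_) (fun x hx => ?_)
  · have : x = 0 := hx
    rw [this]; exact Submodule.zero_mem _
  · have hx' : (u : E →L[ℂ] E) x = 0 := by simpa using hx
    change x = 0
    have := congrArg (u⁻¹ : (E →L[ℂ] E)ˣ).val hx'
    rwa [← mul_apply_eq_comp, Units.inv_mul, map_zero] at this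

theorem IsWeyl.pow {T : E →L[ℂ] E} (hT : IsWeyl T) (n : ℕ) : IsWeyl (T ^ n) :=
  ⟨hT.1.pow n, by rw [index_pow hT.1, hT.2, mul_zero]⟩

/-- All powers have index zero, so once the kernels stabilize, the codimensions of the nested ranges
agree. -/
theorem IsBrowder.hasFiniteDescent {T : E →L[ℂ] E} (hT : IsBrowder T) : HasFiniteDescent T := by
  obtain ⟨hW, n, hn⟩ := hT
  have h1 := (hW.pow n).2
  have h2 := (hW.pow (n + 1)).2
  have := (hW.pow n).1.finiteDimensional_quotient
  have := (hW.pow (n + 1)).1.finiteDimensional_quotient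
  rw [index] at h1 h2
  rw [← hn] at h2
  have hle : (T ^ (n + 1)).range ≤ (T ^ n).range := by
    rintro _ ⟨x, rfl⟩
    exact ⟨T x, by rw [pow_succ]; rfl⟩
  refine ⟨n, le_antisymm ?_ hle⟩
  have hfr : Module.finrank ℂ (E ⧸ (T ^ (n + 1)).range) =
      Module.finrank ℂ (E ⧸ (T ^ n).range) := by omega
  have hinj : Function.Injective (Submodule.factor hle) :=
    (LinearMap.injective_iff_surjective_of_finrank_eq_finrank hfr).2
      (Submodule.factor_surjective hle)
  intro x hx
  rw [← Submodule.Quotient.mk_eq_zero]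
  refine hinj ?_
  rw [map_zero]
  exact (Submodule.Quotient.mk_eq_zero _).2 hx

theorem IsBrowder.exists_projection [CompleteSpace E] {T : E →L[ℂ] E} (hT : IsBrowder T) :
    ∃ P ∈ finiteRankIdeal E, (∀ S, Commute T S → Commute P S) ∧ (∃ n, T ^ n * P = 0) ∧
      IsUnit (T + P) :=
  exists_projection_of_ascent_descent hT.2 hT.hasFiniteDescent fun n => (hT.1.pow n).1.finite_ker

theorem isBrowder_of_ascent_descent [CompleteSpace E] {T : E →L[ℂ] E}
    (ha : HasFiniteAscent T) (hd : HasFiniteDescent T)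
    (hfin : ∀ n, FiniteDimensional ℂ (T ^ n).ker) : IsBrowder T := by
  obtain ⟨P, hP, -, -, hu⟩ := exists_projection_of_ascent_descent ha hd hfin
  refine ⟨?_, ha⟩
  have := (isWeyl_of_isUnit hu).add_finiteRank (neg_mem hP)
  rwa [add_neg_cancel_right] at this

/-- Browder operators are invertible in a punctured neighbourhood of `0`. -/
theorem IsBrowder.eventually_isUnit_shift [CompleteSpace E] {T : E →L[ℂ] E} (hT : IsBrowder T) :
    ∀ᶠ μ in nhdsWithin (0 : ℂ) {0}ᶜ, IsUnit (shift T μ) := by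
  obtain ⟨P, hP, hcomm, ⟨n, hn⟩, hu⟩ := hT.exists_projection
  have hc : Continuous fun μ : ℂ => shift (T + P) μ := by unfold shift; fun_prop
  have hev : ∀ᶠ μ in nhds (0 : ℂ), IsUnit (shift (T + P) μ) :=
    hc.continuousAt.eventually_mem (Units.isOpen.mem_nhds (by simpa [shift] using hu))
  filter_upwards [nhdsWithin_le_nhds hev, self_mem_nhdsWithin] with μ hμ hμ0
  -- The shift is a unit minus `P`, hence Weyl, so only injectivity is missing. An eigenvector `x`
  -- at `μ ≠ 0` satisfies `P x = 0`, hence is killed by the invertible `shift (T + P) μ`.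
  have hW : IsWeyl (shift T μ) := by
    have := (isWeyl_of_isUnit hμ).add_finiteRank (neg_mem hP)
    convert this using 1
    rw [shift, shift]; abel
  refine isUnit_of_injective_of_index_eq_zero hW.1 ?_ hW.2
  rw [injective_iff_map_eq_zero]
  intro x hx
  have hx' : T x = μ • x := sub_eq_zero.1 hx
  have hpow : ∀ m, (T ^ m) x = μ ^ m • x := by
    intro m
    induction m with
    | zero => simp
    | succ m ih =>
      rw [pow_succ', mul_apply_eq_comp, ih, map_smul, hx', smul_smul, pow_succ]
  have hPx : P x = 0 := by
    have h1 : P ((T ^ n) x) = 0 := by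
      have := (hcomm (T ^ n) ((Commute.refl T).pow_right n)).eq
      rw [hn] at this
      exact congrArg (fun f : E →L[ℂ] E => f x) this
    rw [hpow, map_smul] at h1
    exact (smul_eq_zero.1 h1).resolve_left (pow_ne_zero _ hμ0)
  refine (ContinuousLinearMap.isUnit_iff_bijective.1 hμ).1 ?_
  rw [map_zero]
  change T x + P x - μ • x = 0
  rw [hPx, hx']
  simp

end Browder

end WeylType
-- Finite ascent: Riesz perturbations and nearby injectivity.
namespace WeylType

section Ascent

variable {E : Type*} [NormedAddCommGroup E] [NormedSpace ℂ E]

theorem ker_pow_mono (A : E →L[ℂ] E) : Monotone fun n : ℕ => (A ^ n).ker := by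
  refine monotone_nat_of_le_succ fun n x hx => ?_
  have hx' : (A ^ n) x = 0 := hx
  change (A ^ (n + 1)) x = 0
  rw [pow_succ', mul_apply_eq_comp, hx', map_zero]

theorem exists_seq_of_not_hasFiniteAscent {A : E →L[ℂ] E} (hA : ¬ HasFiniteAscent A) :
    ∃ x : ℕ → E, (∀ n, (A ^ (n + 1)) (x n) = 0) ∧ (∀ n, ‖x n‖ = 1) ∧
      ∀ n y, (A ^ n) y = 0 → 1 / 2 ≤ ‖x n - y‖ := by
  have h : ∀ n : ℕ, ∃ x : E, (A ^ (n + 1)) x = 0 ∧ ‖x‖ = 1 ∧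
      ∀ y, (A ^ n) y = 0 → 1 / 2 ≤ ‖x - y‖ := by
    intro n
    let V : Submodule ℂ (A ^ (n + 1)).ker := (A ^ n).ker.comap (A ^ (n + 1)).ker.subtype
    have hV : IsClosed (V : Set (A ^ (n + 1)).ker) :=
      (A ^ n).isClosed_ker.preimage continuous_subtype_val
    have hne : ∃ x, x ∉ V := by
      by_contra! hall
      exact hA ⟨n, le_antisymm (ker_pow_mono A (Nat.le_succ n)) fun x hx => hall ⟨x, hx⟩⟩
    obtain ⟨x, -, hx1, hx2⟩ := riesz_lemma_of_lt_one hV hne (r := 1 / 2) (by norm_num)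
    exact ⟨x, x.2, hx1, fun y hy =>
      hx2 ⟨y, ker_pow_mono A (Nat.le_succ n) hy⟩ hy⟩
  choose x h1 h2 h3 using h
  exact ⟨x, h1, h2, h3⟩

/-- A finite rank operator maps a bounded sequence to one with arbitrarily close terms. -/
theorem exists_lt_norm_sub_lt_of_finiteRank {F : E →L[ℂ] E} (hF : F ∈ finiteRankIdeal E)
    {x : ℕ → E} (hx : ∀ n, ‖x n‖ = 1) {δ : ℝ} (hδ : 0 < δ) :
    ∃ m n, m < n ∧ ‖F (x n) - F (x m)‖ < δ := by
  have hfin : FiniteDimensional ℂ F.range :=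
    have := LinearMap.hasNoetherianRange_iff_range.1 (mem_finiteRankIdeal.1 hF)
    inferInstance
  have := FiniteDimensional.proper ℂ F.range
  let z : ℕ → F.range := fun n => ⟨F (x n), ⟨x n, rfl⟩⟩
  have hz : ∀ n, z n ∈ Metric.closedBall (0 : F.range) ‖F‖ := fun n => by
    rw [mem_closedBall_zero_iff]
    exact (F.le_opNorm (x n)).trans (by rw [hx, mul_one])
  obtain ⟨a, -, φ, hφ, hlim⟩ := tendsto_subseq_of_bounded Metric.isBounded_closedBall hz
  obtain ⟨N, hN⟩ := Metric.cauchySeq_iff'.1 hlim.cauchySeq δ hδ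
  refine ⟨φ N, φ (N + 1), hφ (Nat.lt_succ_self N), ?_⟩
  have := hN (N + 1) (Nat.le_succ N)
  rwa [dist_eq_norm] at this

/-- This adapts the Riesz argument for compact operators. With infinite ascent, Riesz's lemma gives
unit vectors `x n` in successive kernels of powers of `A = R - U`, far from the preceding kernel.
Since `R ^ k` acts on them like the invertible `U ^ k` modulo that kernel, their images stay apart,
although `R ^ k` is close to a finite rank operator. -/
theorem hasFiniteAscent_riesz_sub_isUnit [CompleteSpace E] {R U : E →L[ℂ] E} (hR : IsRiesz R)
    (hU : IsUnit U) (hc : Commute R U) : HasFiniteAscent (R - U) := by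
  by_contra hA
  obtain ⟨s, hUs, hsU⟩ := isUnit_iff_exists.1 hU
  obtain ⟨A, hAdef⟩ : ∃ A, A = R - U := ⟨_, rfl⟩
  rw [← hAdef] at hA
  obtain ⟨x, hx0, hx1, hxd⟩ := exists_seq_of_not_hasFiniteAscent hA
  have hAR : Commute A R := hAdef ▸ (Commute.refl R).sub_left hc.symm
  have hAU : Commute A U := hAdef ▸ hc.sub_left (Commute.refl _)
  have hcs : Commute s A := by
    have h1 := congrArg (fun B => s * B * s) hAU.eq
    simp only [mul_assoc, hUs, mul_one] at h1
    rw [← mul_assoc s U, hsU, one_mul] at h1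
    exact h1
  set C : ℝ := ‖s‖ + 1 with hC
  have hCpos : 0 < C := by positivity
  -- As `k ≥ 1`, the error is below `(C⁻¹) ^ k / 8`. Three such errors total `3/8`, less than the
  -- separation `1/2`, in units of `(C⁻¹) ^ k`.
  obtain ⟨k, hk, F, hF, hFR⟩ := exists_norm_pow_sub_finiteRank_lt hR
    (ε := C⁻¹ / 8) (by positivity)
  have hδ : 0 < (C⁻¹) ^ k / 8 := by positivity
  have hFR' : ‖R ^ k - F‖ < (C⁻¹) ^ k / 8 := by
    refine hFR.trans_le ?_
    rw [div_pow]
    gcongr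
    exact le_self_pow₀ (by norm_num) hk
  obtain ⟨m, n, hmn, hd⟩ := exists_lt_norm_sub_lt_of_finiteRank hF hx1 hδ
  obtain ⟨S, hS, hSA⟩ : ∃ S : E →L[ℂ] E, R ^ k - U ^ k = S * A ∧ Commute A S := by
    refine ⟨∑ i ∈ Finset.range k, R ^ i * U ^ (k - 1 - i), by
      rw [hAdef, hc.geom_sum₂_mul k], ?_⟩
    refine Commute.sum_right _ _ _ fun i _ => ?_
    exact (hAR.pow_right i).mul_right (hAU.pow_right _)
  have happ : ∀ {B D : E →L[ℂ] E}, Commute B D → ∀ y, B (D y) = D (B y) := fun h y =>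
    congrArg (fun f : E →L[ℂ] E => f y) h.eq
  -- modulo the kernel of `A ^ n`, the operator `R ^ k` acts on `x n` like `U ^ k`
  have hv1 : (A ^ n) ((R ^ k - U ^ k) (x n)) = 0 := by
    rw [hS, mul_apply_eq_comp, happ (hSA.pow_left n), ← mul_apply_eq_comp,
      ← mul_apply_eq_comp, mul_assoc, ← pow_succ, mul_apply_eq_comp, hx0,
      map_zero]
  have hv2 : (A ^ n) ((R ^ k) (x m)) = 0 := by
    rw [happ ((hAR.pow_left n).pow_right k),
      show (A ^ n) (x m) = 0 from ker_pow_mono A (Nat.succ_le_of_lt hmn) (hx0 m), map_zero]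
  set v : E := (R ^ k - U ^ k) (x n) - (R ^ k) (x m) with hv
  have hAv : (A ^ n) v = 0 := by rw [hv, map_sub, hv1, hv2, sub_zero]
  have hAsv : (A ^ n) (-(s ^ k) v) = 0 := by
    rw [map_neg, happ ((hcs.symm.pow_left n).pow_right k), hAv, map_zero, neg_zero]
  have hcU : Commute s U := hsU.trans hUs.symm
  have hsu : (s ^ k) ((U ^ k) (x n)) = x n := by
    rw [← mul_apply_eq_comp, ← hcU.mul_pow, hsU, one_pow]
    rfl
  have hdiff : (R ^ k) (x n) - (R ^ k) (x m) = (U ^ k) (x n) + v := by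
    rw [hv, sub_apply]; abel
  have hlow : 1 / 2 ≤ C ^ k * ‖(R ^ k) (x n) - (R ^ k) (x m)‖ := by
    calc 1 / 2 ≤ ‖x n - -(s ^ k) v‖ := hxd n _ hAsv
      _ = ‖(s ^ k) ((R ^ k) (x n) - (R ^ k) (x m))‖ := by
        rw [hdiff, map_add, hsu, sub_neg_eq_add]
      _ ≤ ‖s ^ k‖ * ‖(R ^ k) (x n) - (R ^ k) (x m)‖ := (s ^ k).le_opNorm _
      _ ≤ C ^ k * ‖(R ^ k) (x n) - (R ^ k) (x m)‖ := by
        gcongr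
        exact (norm_pow_le' _ (Nat.pos_of_ne_zero hk)).trans (by gcongr; linarith)
  have hE : ∀ i, ‖(R ^ k - F) (x i)‖ ≤ (C⁻¹) ^ k / 8 := fun i =>
    ((R ^ k - F).le_opNorm (x i)).trans (by rw [hx1, mul_one]; exact hFR'.le)
  have hup : ‖(R ^ k) (x n) - (R ^ k) (x m)‖ < 3 * ((C⁻¹) ^ k / 8) := by
    have : (R ^ k) (x n) - (R ^ k) (x m) =
        (F (x n) - F (x m)) + ((R ^ k - F) (x n) - (R ^ k - F) (x m)) := by
      simp only [sub_apply]; abel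
    rw [this]
    have h1 := norm_add_le (F (x n) - F (x m)) ((R ^ k - F) (x n) - (R ^ k - F) (x m))
    have h2 := norm_sub_le ((R ^ k - F) (x n)) ((R ^ k - F) (x m))
    linarith [hE n, hE m]
  have hCk : C ^ k * (C⁻¹) ^ k = 1 := by
    rw [← mul_pow, mul_inv_cancel₀ hCpos.ne', one_pow]
  have := mul_lt_mul_of_pos_left hup (pow_pos hCpos k)
  nlinarith

/-- Browder operators are stable under commuting Riesz perturbations. -/
theorem IsBrowder.add_riesz [CompleteSpace E] {T R : E →L[ℂ] E} (hT : IsBrowder T)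
    (hR : IsRiesz R) (hTR : Commute T R) : IsBrowder (T + R) := by
  refine ⟨hT.1.add_riesz hR hTR, ?_⟩
  obtain ⟨P, hP, hcomm, -, hu⟩ := hT.exists_projection
  have hPR : Commute P R := hcomm R hTR
  have hPT : Commute P T := hcomm T (Commute.refl T)
  -- Write `T + R = (R - P) - (-(T + P))`, a Riesz operator minus a commuting unit.
  have h1 : Commute (R + -P) (T + P) :=
    (hTR.symm.add_right hPR.symm).add_left (hPT.add_right (Commute.refl P)).neg_left
  have := hasFiniteAscent_riesz_sub_isUnit (hR.add_finiteRank (neg_mem hP)) hu.neg h1.neg_right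
  convert this using 1
  abel

theorem range_pow_anti (T : E →L[ℂ] E) : Antitone fun n : ℕ => (T ^ n).range := by
  refine antitone_nat_of_succ_le fun n => ?_
  rintro _ ⟨x, rfl⟩
  exact ⟨T x, by rw [pow_succ]; rfl⟩

theorem isFredholm_of_surjective [CompleteSpace E] {T : E →L[ℂ] E}
    (hs : Function.Surjective T) (hk : FiniteDimensional ℂ T.ker) : T.IsFredholm where
  isStrictMap := ((T.isOpenMap hs).isQuotientMap T.continuous hs).isStrictMap
  isClosed_range := by
    rw [LinearMap.range_eq_top.2 hs]; exact isClosed_univ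
  finite_ker := hk
  finite_coker := by
    rw [LinearMap.range_eq_top.2 hs]; exact Submodule.CoFG.top
  closedComplemented_ker := Submodule.ClosedComplemented.of_finiteDimensional _

/-- A Fredholm operator `T` such that `T - μ I` is injective for `μ` arbitrarily close to `0`
has finite ascent. -/
theorem hasFiniteAscent_of_frequently_injective [CompleteSpace E] {T : E →L[ℂ] E}
    (hT : T.IsFredholm)
    (h : ∃ᶠ μ in nhds (0 : ℂ), Function.Injective (shift T μ)) : HasFiniteAscent T := by
  have hker := hT.finite_ker
  -- the intersections of the ranges of the powers with the kernel stabilize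
  let g : ℕ →o (Submodule ℂ T.ker)ᵒᵈ :=
    ⟨fun n => OrderDual.toDual ((T ^ n).range.comap T.ker.subtype), fun m n hmn =>
      Submodule.comap_mono (range_pow_anti T hmn)⟩
  obtain ⟨N, hN⟩ := IsArtinian.monotone_stabilizes g
  have hstab : ∀ n, ∀ x, T x = 0 → x ∈ (T ^ N).range → x ∈ (T ^ n).range := by
    intro n x hx hxN
    have h1 : (T ^ N).range.comap T.ker.subtype = (T ^ (N + n)).range.comap T.ker.subtype :=
      hN (N + n) (Nat.le_add_right N n)
    have h2 : (⟨x, hx⟩ : T.ker) ∈ (T ^ N).range.comap T.ker.subtype := hxN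
    rw [h1] at h2
    exact range_pow_anti T (Nat.le_add_left n N) h2
  -- On the closed invariant subspace `Y`, `T` is onto: two preimages of a point of `Y` taken in the
  -- range of `T ^ N` differ by a kernel vector, which by `hstab` lies in every range.
  let Y : Submodule ℂ E := ⨅ n, (T ^ n).range
  have hYmem : ∀ x, x ∈ Y ↔ ∀ n, x ∈ (T ^ n).range := fun x => Submodule.mem_iInf _
  have hYc : IsClosed (Y : Set E) := by
    rw [Submodule.coe_iInf]
    exact isClosed_iInter fun n => (hT.pow n).isClosed_range
  have : CompleteSpace Y := hYc.completeSpace_coe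
  have hYT : ∀ x ∈ Y, T x ∈ Y := by
    intro x hx
    rw [hYmem] at hx ⊢
    intro n
    obtain ⟨y, rfl⟩ := hx n
    refine ⟨T y, ?_⟩
    exact congrArg (fun f : E →L[ℂ] E => f y) ((Commute.refl T).pow_left n).eq
  let TY : Y →L[ℂ] Y := T.restrict hYT
  have hTY : ∀ y : Y, (TY y : E) = T y := fun y => rfl
  have hsurj : Function.Surjective TY := by
    rintro ⟨y, hy⟩
    have hy' := (hYmem y).1 hy
    have hpre : ∀ n, ∃ z ∈ (T ^ n).range, T z = y := by
      intro n
      obtain ⟨w, hw⟩ := hy' (n + 1)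
      refine ⟨(T ^ n) w, ⟨w, rfl⟩, ?_⟩
      rw [← hw, pow_succ']
      rfl
    obtain ⟨z, hz, hzy⟩ := hpre N
    have hzY : z ∈ Y := by
      rw [hYmem]
      intro n
      obtain ⟨w, hw, hwy⟩ := hpre (max n N)
      have h1 : T (z - w) = 0 := by rw [map_sub, hzy, hwy, sub_self]
      have h2 : z - w ∈ (T ^ N).range :=
        Submodule.sub_mem _ hz (range_pow_anti T (le_max_right n N) hw)
      have h3 := Submodule.add_mem _ (hstab n _ h1 h2) (range_pow_anti T (le_max_left n N) hw)
      rwa [sub_add_cancel] at h3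
    exact ⟨⟨z, hzY⟩, Subtype.ext hzy⟩
  have hkY : FiniteDimensional ℂ TY.ker := by
    let i : TY.ker →ₗ[ℂ] T.ker :=
      { toFun := fun y => ⟨y.1.1, congrArg Subtype.val y.2⟩
        map_add' := fun _ _ => rfl
        map_smul' := fun _ _ => rfl }
    exact FiniteDimensional.of_injective i fun a b hab =>
      Subtype.ext (Subtype.ext (congrArg (fun z : T.ker => (z : E)) hab))
  have hF := isFredholm_of_surjective hsurj hkY
  have hcont : Continuous fun μ : ℂ => shift TY μ := by unfold shift; fun_prop
  have hev : ∀ᶠ μ in nhds (0 : ℂ), (shift TY μ).IsFredholm ∧ index (shift TY μ) = index TY := by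
    have h0 : shift TY 0 = TY := by simp [shift]
    have := eventually_isFredholm_index_eq hF
    rw [← h0] at this ⊢
    simpa [h0] using hcont.continuousAt.eventually this
  -- The surjective `TY` has index at least zero, its injective shift at most zero; as these agree,
  -- `TY` is injective.
  obtain ⟨μ, hinj, -, hind⟩ := (h.and_eventually hev).exists
  have hinjY : Function.Injective (shift TY μ) := by
    intro a b hab
    exact Subtype.ext (hinj (congrArg Subtype.val hab))
  have hi1 : index (shift TY μ) = -(Module.finrank ℂ (Y ⧸ (shift TY μ).range) : ℤ) :=
    LinearMap.index_of_injective (f := (shift TY μ : Y →ₗ[ℂ] Y)) hinjY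
  have hi2 : index TY = Module.finrank ℂ TY.ker :=
    LinearMap.index_of_surjective (f := (TY : Y →ₗ[ℂ] Y)) hsurj
  have hker0 : TY.ker = ⊥ := Submodule.finrank_eq_zero.1 (by omega)
  refine ⟨N, le_antisymm (ker_pow_mono T (Nat.le_succ N)) fun x hx => ?_⟩
  have hx' : T ((T ^ N) x) = 0 := by
    rw [← mul_apply_eq_comp, ← pow_succ']
    exact hx
  have hxY : (T ^ N) x ∈ Y := (hYmem _).2 fun n => hstab n _ hx' ⟨x, rfl⟩
  have : (⟨(T ^ N) x, hxY⟩ : Y) ∈ TY.ker := Subtype.ext hx'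
  rw [hker0] at this
  exact congrArg Subtype.val this

end Ascent

end WeylType
-- Spectral sets in terms of Weyl and Browder shifts.
namespace WeylType

section Spectra

variable {E : Type*} [NormedAddCommGroup E] [NormedSpace ℂ E]

theorem shift_shift (T : E →L[ℂ] E) (μ ν : ℂ) : shift (shift T μ) ν = shift T (μ + ν) := by
  rw [shift, shift, shift, add_smul]; abel

theorem shift_add (T R : E →L[ℂ] E) (μ : ℂ) : shift (T + R) μ = shift T μ + R := by
  rw [shift, shift]; abel

theorem commute_shift {T R : E →L[ℂ] E} (h : Commute T R) (μ : ℂ) : Commute (shift T μ) R :=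
  h.sub_left ((Commute.one_left R).smul_left μ)

theorem mem_spectrum_iff_not_isUnit_shift {T : E →L[ℂ] E} {μ : ℂ} :
    μ ∈ spectrum ℂ T ↔ ¬ IsUnit (shift T μ) := by
  rw [spectrum.mem_iff, ← IsUnit.neg_iff, neg_sub, Algebra.algebraMap_eq_smul_one]
  rfl

theorem mem_pointSpectrum_iff_not_injective {T : E →L[ℂ] E} {μ : ℂ} :
    μ ∈ pointSpectrum T ↔ ¬ Function.Injective (shift T μ) := by
  have h : Module.End.eigenspace (T : Module.End ℂ E) μ = (shift T μ).ker := by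
    ext x
    rw [Module.End.mem_eigenspace_iff, ← sub_eq_zero]
    rfl
  change Module.End.eigenspace (T : Module.End ℂ E) μ ≠ ⊥ ↔ _
  rw [h, Ne, LinearMap.ker_eq_bot]
  rfl

theorem IsBoundedBelow.injective {T : E →L[ℂ] E} (hT : IsBoundedBelow T) :
    Function.Injective T := by
  obtain ⟨c, hc, h⟩ := hT
  rw [injective_iff_map_eq_zero]
  intro x hx
  have := h x
  rw [hx, norm_zero] at this
  exact norm_le_zero_iff.1 (nonpos_of_mul_nonpos_right this hc)

theorem isBoundedBelow_of_isUnit {T : E →L[ℂ] E} (hT : IsUnit T) : IsBoundedBelow T := by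
  obtain ⟨u, rfl⟩ := hT
  refine ⟨(‖((u⁻¹ : (E →L[ℂ] E)ˣ) : E →L[ℂ] E)‖ + 1)⁻¹, by positivity, fun x => ?_⟩
  have h : ((u⁻¹ : (E →L[ℂ] E)ˣ) : E →L[ℂ] E) ((u : E →L[ℂ] E) x) = x := by
    rw [← mul_apply_eq_comp, Units.inv_mul]; rfl
  rw [inv_mul_le_iff₀ (by positivity)]
  calc ‖x‖ = ‖((u⁻¹ : (E →L[ℂ] E)ˣ) : E →L[ℂ] E) ((u : E →L[ℂ] E) x)‖ := by rw [h]
    _ ≤ ‖((u⁻¹ : (E →L[ℂ] E)ˣ) : E →L[ℂ] E)‖ * ‖(u : E →L[ℂ] E) x‖ :=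
      ContinuousLinearMap.le_opNorm _ _
    _ ≤ _ := by gcongr; linarith

theorem mem_maxGenEigenspace_iff {T : E →L[ℂ] E} {μ : ℂ} {x : E} :
    x ∈ Module.End.maxGenEigenspace (T : Module.End ℂ E) μ ↔ ∃ k, (shift T μ ^ k) x = 0 := by
  rw [Module.End.mem_maxGenEigenspace]
  have h : (T : Module.End ℂ E) - μ • 1 = (shift T μ : Module.End ℂ E) := rfl
  simp only [h, ← ContinuousLinearMap.toLinearMap_pow]
  rfl

variable [CompleteSpace E]

/-- The poles of finite rank are the points of the spectrum outside the Browder spectrum. -/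
theorem mem_polesFiniteRank_iff {T : E →L[ℂ] E} {μ : ℂ} :
    μ ∈ polesFiniteRank T ↔ μ ∈ spectrum ℂ T ∧ IsBrowder (shift T μ) := by
  constructor
  · rintro ⟨⟨hs, ha, hd⟩, hfin⟩
    refine ⟨hs, isBrowder_of_ascent_descent ha hd fun n => ?_⟩
    exact Submodule.finiteDimensional_of_le fun x hx => mem_maxGenEigenspace_iff.2 ⟨n, hx⟩
  · rintro ⟨hs, hB⟩
    refine ⟨⟨hs, hB.2, hB.hasFiniteDescent⟩, ?_⟩
    obtain ⟨hW, n, hn⟩ := hB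
    have := (hW.1.pow n).finite_ker
    refine Submodule.finiteDimensional_of_le (S₂ := (shift T μ ^ n).ker) fun x hx => ?_
    obtain ⟨k, hk⟩ := mem_maxGenEigenspace_iff.1 hx
    exact mem_ker_pow_add_of_ker_pow_eq hn k (ker_pow_mono _ (Nat.le_add_left k n) hk)

/-- A noninvertible operator of index zero is not injective, which gives the eigenvalue;
invertibility of nearby shifts gives isolation. -/
theorem polesFiniteRank_subset_Ea (T : E →L[ℂ] E) : polesFiniteRank T ⊆ Ea T := by
  intro μ hμ
  obtain ⟨hs, hB⟩ := mem_polesFiniteRank_iff.1 hμ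
  have hninj : ¬ Function.Injective (shift T μ) := fun hinj =>
    mem_spectrum_iff_not_isUnit_shift.1 hs
      (isUnit_of_injective_of_index_eq_zero hB.1.1 hinj hB.1.2)
  refine ⟨⟨fun hb => hninj hb.injective, ?_⟩, mem_pointSpectrum_iff_not_injective.2 hninj⟩
  rw [accPt_iff_frequently, Filter.not_frequently]
  have hlim : Filter.Tendsto (fun ν : ℂ => ν - μ) (nhds μ) (nhds 0) := by
    have : Continuous fun ν : ℂ => ν - μ := by fun_prop
    simpa using this.tendsto μ
  filter_upwards [hlim.eventually (eventually_nhdsWithin_iff.1 hB.eventually_isUnit_shift)]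
  rintro ν hν ⟨hne, hmem⟩
  have := hν (sub_ne_zero.2 hne)
  rw [shift_shift, add_sub_cancel] at this
  exact hmem (isBoundedBelow_of_isUnit this)

theorem isBrowder_of_isWeyl_of_mem_iso {T : E →L[ℂ] E} {μ : ℂ} (hW : IsWeyl (shift T μ))
    (hμ : μ ∈ iso (approxPointSpectrum T)) : IsBrowder (shift T μ) := by
  refine ⟨hW, hasFiniteAscent_of_frequently_injective hW.1 ?_⟩
  have hacc := hμ.2
  rw [accPt_iff_frequently, Filter.not_frequently] at hacc
  have hlim : Filter.Tendsto (fun ν : ℂ => μ + ν) (nhds 0) (nhds μ) := by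
    have : Continuous fun ν : ℂ => μ + ν := by fun_prop
    simpa using this.tendsto 0
  have hne : ∃ᶠ ν in nhds (0 : ℂ), ν ≠ 0 := by
    have : (nhdsWithin (0 : ℂ) {0}ᶜ).NeBot := inferInstance
    exact Filter.frequently_mem_iff_neBot.2 this
  refine (hne.and_eventually (hlim.eventually hacc)).mono ?_
  rintro ν ⟨hν, h⟩
  rw [shift_shift]
  by_contra hinj
  exact h ⟨by simpa using hν, fun hb => hinj hb.injective⟩

/-- This is Browder's theorem for `T`, the only consequence of its property that the equivalence
needs. -/
theorem isBrowder_shift_of_propertyZEa {T : E →L[ℂ] E} (hT : PropertyZEa T) {μ : ℂ}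
    (hW : IsWeyl (shift T μ)) : IsBrowder (shift T μ) := by
  by_cases hs : μ ∈ spectrum ℂ T
  · have : μ ∈ spectrum ℂ T \ weylSpectrum T := ⟨hs, fun h => h hW⟩
    rw [hT] at this
    exact isBrowder_of_isWeyl_of_mem_iso hW this.1
  · rw [mem_spectrum_iff_not_isUnit_shift, not_not] at hs
    exact isBrowder_of_isUnit hs

theorem spectrum_diff_weylSpectrum_eq {T : E →L[ℂ] E}
    (hT : ∀ μ, IsWeyl (shift T μ) → IsBrowder (shift T μ)) :
    spectrum ℂ T \ weylSpectrum T = polesFiniteRank T := by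
  ext μ
  rw [mem_polesFiniteRank_iff]
  exact and_congr_right fun _ => ⟨fun h => hT μ (not_not.1 h), fun h hn => hn h.1⟩

theorem isBrowder_shift_add_riesz_iff {T R : E →L[ℂ] E} (hR : IsRiesz R) (hTR : Commute T R)
    {μ : ℂ} : IsBrowder (shift (T + R) μ) ↔ IsBrowder (shift T μ) := by
  rw [shift_add]
  have hc := commute_shift hTR μ
  refine ⟨fun h => ?_, fun h => h.add_riesz hR hc⟩
  have hR' : IsRiesz (-R) := by simpa using hR.smul (-1)
  have := h.add_riesz hR' (hc.add_left (Commute.refl R)).neg_right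
  rwa [add_neg_cancel_right] at this

theorem isWeyl_of_isWeyl_add_riesz {T R : E →L[ℂ] E} (hR : IsRiesz R) (hTR : Commute T R)
    (h : IsWeyl (T + R)) : IsWeyl T := by
  have hR' : IsRiesz (-R) := by simpa using hR.smul (-1)
  have := h.add_riesz hR' (hTR.add_left (Commute.refl R)).neg_right
  rwa [add_neg_cancel_right] at this

end Spectra

end WeylType

/-! ### The equivalence. -/

theorem theorem3 {X : Type*} [NormedAddCommGroup X] [NormedSpace ℂ X] [CompleteSpace X]
    (hX : ¬ FiniteDimensional ℂ X) (T R : X →L[ℂ] X)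
    (hR : WeylType.IsRiesz R) (hTR : Commute T R) (hT : WeylType.PropertyZEa T) :
    List.TFAE [
      WeylType.PropertyZEa (T + R),
      WeylType.Ea (T + R) = WeylType.polesFiniteRank (T + R),
      WeylType.Ea (T + R) ∩ spectrum ℂ T ⊆ WeylType.polesFiniteRank T] := by
  -- Browder's theorem passes from `T` to `T + R`: remove `R` from the Weyl shift, apply it to `T`,
  -- and add `R` back.
  have hBR : ∀ μ, WeylType.IsWeyl (WeylType.shift (T + R) μ) →
      WeylType.IsBrowder (WeylType.shift (T + R) μ) := fun μ hμ => by
    rw [WeylType.isBrowder_shift_add_riesz_iff hR hTR]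
    rw [WeylType.shift_add] at hμ
    exact WeylType.isBrowder_shift_of_propertyZEa hT
      (WeylType.isWeyl_of_isWeyl_add_riesz hR (WeylType.commute_shift hTR μ) hμ)
  tfae_have 1 ↔ 2 := by
    rw [WeylType.PropertyZEa, WeylType.spectrum_diff_weylSpectrum_eq hBR, eq_comm]
  tfae_have 2 → 3 := by
    rintro h μ ⟨hμ, hs⟩
    rw [h, WeylType.mem_polesFiniteRank_iff, WeylType.isBrowder_shift_add_riesz_iff hR hTR] at hμ
    exact WeylType.mem_polesFiniteRank_iff.2 ⟨hs, hμ.2⟩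
  tfae_have 3 → 2 := by
    intro h
    refine subset_antisymm (fun μ hμ => ?_) (WeylType.polesFiniteRank_subset_Ea _)
    rw [WeylType.mem_polesFiniteRank_iff, WeylType.isBrowder_shift_add_riesz_iff hR hTR]
    refine ⟨WeylType.mem_spectrum_iff_not_isUnit_shift.2 fun hu =>
      hμ.1.1 (WeylType.isBoundedBelow_of_isUnit hu), ?_⟩
    by_cases hs : μ ∈ spectrum ℂ T
    · exact (WeylType.mem_polesFiniteRank_iff.1 (h ⟨hμ, hs⟩)).2
    · rw [WeylType.mem_spectrum_iff_not_isUnit_shift, not_not] at hs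
      exact WeylType.isBrowder_of_isUnit hs
  tfae_finish
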